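/- A market $\mathcal M=(I,\Omega,v)$ consists of a finite set $I$ of $n$ agents, a finite ordered set $\Omega$ of $m$ trades, where each trade $\omega$ has a buyer $b(\omega)\in I$ and a seller $s(\omega)\in I$, $s(\omega)\neq b(\omega)$, and valuations $v^i:2^{\Omega_i}\to\mathbb R$ with $v^i(\emptyset)=0$, where $\Omega_i$ is the set of trades involving agent $i$. Let $\Delta=\max_i|\Omega_i|$, and let $\chi^i_\omega$ be $1$ if $i=b(\omega)$, $-1$ if $i=s(\omega)$, and $0$ otherwise. At prices $p\in\mathbb R^\Omega$, the demand $D^i(p)$ is the set of bundles $\Psi\subseteq\Omega_i$ that maximize $v^i(\Psi)-\sum_{\omega\in\Psi}\chi^i_\omega p_\omega$, and $d^i(p)$ is the lexicographically smallest bundle (bundles being read as increasing lists of trades) among those of maximum cardinality in $D^i(p)$. Let $P^*$ be the set of competitive equilibrium prices: those $p\in\mathbb R^\Omega$ for which there is a set $\Phi\subseteq\Omega$ with $\Phi\cap\Omega_i\in D^i(p)$ for every agent $i$. Given a number $T\ge 1$ of rounds, a step size $\varepsilon$ and initial prices $p^0\in[-R,R]^\Omega$, the stochastic clock price dynamics picks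 in each round $t=0,\dots,T-1$ an agent $i$ uniformly at random, independently of the other rounds, and sets $p^{t+1}_\omega=p^t_\omega-\varepsilon\chi^i_\omega$ for $\omega\in\Omega_i\setminus d^i(p^t)$ and $p^{t+1}_\omega=p^t_\omega$ for all other trades. Let $\bar p=\frac1T\sum_{t=1}^T p^t$ and $d(p,P^*)=\min_{q\in P^*}\|p-q\|_\infty$. **Proposition.** For all integers $n,m,\Delta\ge 1$ and all real $R\ge 0$ there is a constant $C=C(n,m,\Delta,R)$ such that the following holds. Let $\mathcal M$ be a market with $n$ agents, $m$ trades and maximum vertex degree $\Delta$, with $|v^i(\Psi)|\le R$ for every agent $i$ and every bundle $\Psi\subseteq\Omega_i$, and with $P^*\neq\emptyset$. Let $p^0\in[-R,R]^\Omega$ be arbitrary, and run the price dynamics with step size $\varepsilon=R\sqrt{\frac{2m}{T\Delta}}$. Then, for every integer $T\ge 1$ with $T\ge 2n^2R^2m\Delta$, $$\mathbb E\big[d(\bar p,P^*)\big]\le\frac{C}{\sqrt T}.$$ -/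

import Mathlib

open scoped BigOperators

noncomputable section

/-- A trading network market with agents `I` and bilateral trades `Ω` (a directed multigraph on
`I`), together with the agents' valuations. Only the values `v i Ψ` for bundles `Ψ` of trades that
involve `i` matter below. -/
structure Market (I Ω : Type*) where
  buyer : Ω → I
  seller : Ω → I
  buyer_ne_seller : ∀ ω, buyer ω ≠ seller ω
  v : I → Finset Ω → ℝ
  v_empty : ∀ i, v i ∅ = 0

namespace Market

section Basic

variable {I Ω : Type*} [Fintype Ω] (M : Market I Ω)

open Classical in
/-- `Ω_i`: the trades that involve agent `i`. -/
def trades (i : I) : Finset Ω :=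
  Finset.univ.filter fun ω => M.buyer ω = i ∨ M.seller ω = i

/-- `Δ`: the maximum number of trades in which an individual agent is involved. -/
def maxDegree [Fintype I] : ℕ :=
  Finset.univ.sup fun i => (M.trades i).card

open Classical in
/-- `χ^i_ω`: `1` if `i` buys `ω`, `-1` if `i` sells `ω`, and `0` otherwise. -/
def chi (i : I) (ω : Ω) : ℝ :=
  if M.buyer ω = i then 1 else if M.seller ω = i then -1 else 0

/-- The quasi-linear utility `u^i(Ψ, p)`. -/
def utility (i : I) (Ψ : Finset Ω) (p : Ω → ℝ) : ℝ :=
  M.v i Ψ - ∑ ω ∈ Ψ, M.chi i ω * p ω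

/-- `D^i(p)`: the bundles `Ψ ⊆ Ω_i` that maximize the utility of `i` at prices `p`. -/
def demand (i : I) (p : Ω → ℝ) : Set (Finset Ω) :=
  {Ψ | Ψ ⊆ M.trades i ∧ ∀ Ψ' ⊆ M.trades i, M.utility i Ψ' p ≤ M.utility i Ψ p}

open Classical in
/-- `(p, Φ)` is a competitive equilibrium: every agent `i` demands `Φ_i = Φ ∩ Ω_i` at `p`. -/
def IsCompetitiveEquilibrium (p : Ω → ℝ) (Φ : Finset Ω) : Prop :=
  ∀ i, Φ ∩ M.trades i ∈ M.demand i p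

/-- `P*`: the set of competitive equilibrium prices. -/
def equilibriumPrices : Set (Ω → ℝ) :=
  {p | ∃ Φ, M.IsCompetitiveEquilibrium p Φ}

/-- The absolute value of every agent's valuation is at most `R`. -/
def ValuationsBoundedBy (R : ℝ) : Prop :=
  ∀ i, ∀ Ψ ⊆ M.trades i, |M.v i Ψ| ≤ R

theorem demand_nonempty (i : I) (p : Ω → ℝ) : (M.demand i p).Nonempty := by
  obtain ⟨Ψ, hΨ, hmax⟩ := (M.trades i).powerset.exists_max_image (fun Ψ => M.utility i Ψ p)
    ⟨∅, by simp⟩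
  exact ⟨Ψ, by simpa using hΨ, fun Ψ' h => hmax Ψ' (by simpa using h)⟩

end Basic

section Dynamics

variable {I Ω : Type*} [Fintype Ω] [LinearOrder Ω] (M : Market I Ω)

theorem exists_tieBreak (i : I) (p : Ω → ℝ) :
    ∃ Φ ∈ M.demand i p, (∀ Ψ ∈ M.demand i p, Ψ.card ≤ Φ.card) ∧
      ∀ Ψ ∈ M.demand i p, Ψ.card = Φ.card → Φ.sort (· ≤ ·) ≤ Ψ.sort (· ≤ ·) := by
  classical
  obtain ⟨Φ₀, h₀, hmax⟩ := (M.demand i p).toFinite.exists_maximalFor Finset.card _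
    (M.demand_nonempty i p)
  have hmax' : ∀ Ψ ∈ M.demand i p, Ψ.card ≤ Φ₀.card := fun Ψ hΨ =>
    (le_total Ψ.card Φ₀.card).elim id fun h => hmax hΨ h
  obtain ⟨Φ, hΦ, hmin⟩ := Finset.exists_min_image
    (Finset.univ.filter fun Φ => Φ ∈ M.demand i p ∧ Φ.card = Φ₀.card)
    (fun Φ => Φ.sort (· ≤ ·)) ⟨Φ₀, by simp [h₀]⟩
  simp only [Finset.mem_filter, Finset.mem_univ, true_and] at hΦ hmin
  exact ⟨Φ, hΦ.1, fun Ψ hΨ => hΦ.2 ▸ hmax' Ψ hΨ, fun Ψ hΨ h => hmin Ψ ⟨hΨ, h.trans hΦ.2⟩⟩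

/-- `d^i(p)`: among the demanded bundles of maximum cardinality, the lexicographically smallest one
(bundles are compared as lists of trades in increasing order). -/
def tieBreak (i : I) (p : Ω → ℝ) : Finset Ω :=
  (M.exists_tieBreak i p).choose

/-- The price update when agent `i` is active at prices `p`. -/
def priceUpdate (ε : ℝ) (i : I) (p : Ω → ℝ) : Ω → ℝ := fun ω =>
  if ω ∈ M.trades i \ M.tieBreak i p then p ω - ε * M.chi i ω else p ω

/-- The prices `p^t`, `t ≤ T`, of the price dynamics started at `p0`, when `a 0, …, a (T - 1)` are
the agents activated in the `T` successive rounds. (For `t > T` the prices stay put.) -/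
def price (ε : ℝ) (p0 : Ω → ℝ) {T : ℕ} (a : Fin T → I) : ℕ → Ω → ℝ
  | 0 => p0
  | t + 1 =>
    if h : t < T then M.priceUpdate ε (a ⟨t, h⟩) (price ε p0 a t) else price ε p0 a t

/-- The average price vector `(1 / T) ∑_{t = 1}^T p^t`. -/
def averagePrice (ε : ℝ) (p0 : Ω → ℝ) {T : ℕ} (a : Fin T → I) : Ω → ℝ :=
  (1 / (T : ℝ)) • ∑ t ∈ Finset.Icc 1 T, M.price ε p0 a t

/-- The expected `ℓ^∞`-distance of the average price vector from the set of competitive equilibrium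
prices, when the active agents of the `T` rounds are drawn independently and uniformly from `I`:
the sequence of active agents is then uniform on `Fin T → I`, and `𝔼` is the uniform average.
The distance of `Ω → ℝ` is the one of the supremum norm. -/
def expectedDistance [Fintype I] (ε : ℝ) (p0 : Ω → ℝ) (T : ℕ) : ℝ :=
  𝔼 a : Fin T → I, Metric.infDist (M.averagePrice ε p0 a) M.equilibriumPrices

end Dynamics

end Market

end

/-! The dynamics is stochastic subgradient descent on the sum of indirect utilities
(`Market.potential`), a maximum of finitely many affine functions. By duality its minimizers are
exactly the equilibrium prices, once one exists. The usual telescoping of squared distances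
(`expect_sum_potential_sub_le`) with ε of order 1/√T makes the expected average potential gap
O(1/√T), and convexity passes this to the averaged price.

To turn a potential gap into a distance, write P* as a system of linear inequalities, one per choice
of bundles. The coefficients lie in {-1, 0, 1}, so Hoffman's bound holds with a constant depending
on m alone, not on the valuations (`exists_dist_le_mul_potential_sub`). The same bound controls the
distance from the initial price to P*. -/

/-! ### Error bounds for linear inequalities -/

theorem exists_abs_sub_le_of_forall_le {J₁ J₂ : Type*} [Finite J₁] (l : J₁ → ℝ) (u : J₂ → ℝ)
    (p s : ℝ) (hs : 0 ≤ s) (hlu : ∀ i j, l i ≤ u j) (hl : ∀ i, l i - s ≤ p)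
    (hu : ∀ j, p ≤ u j + s) :
    ∃ q, (∀ i, l i ≤ q) ∧ (∀ j, q ≤ u j) ∧ |p - q| ≤ s := by
  -- The witness is the maximum of p - s and all lower bounds; `none` stands for p - s, which also
  -- covers an empty `J₁`.
  obtain ⟨o, ho⟩ := Finite.exists_max (fun o : Option J₁ => o.elim (p - s) l)
  refine ⟨o.elim (p - s) l, fun i => ho (some i), fun j => ?_, ?_⟩
  · cases o with
    | none => simpa using hu j
    | some i => exact hlu i j
  · have h₁ : p - s ≤ o.elim (p - s) l := ho none
    have h₂ : o.elim (p - s) l ≤ p + s := by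
      cases o with
      | none => simp only [Option.elim]; linarith
      | some i => simp only [Option.elim]; linarith [hl i]
    rw [abs_le]
    constructor <;> linarith

/-- **Hoffman's error bound**, by Fourier–Motzkin elimination. The constant depends only on a finite
set containing the coefficient vectors. -/
theorem exists_hoffman_bound.{w} (d : ℕ) (A : Set (Fin d → ℝ)) (hA : A.Finite) :
    ∃ K : ℝ, 0 ≤ K ∧ ∀ (J : Type w) [Finite J] (a : J → Fin d → ℝ) (b : J → ℝ),
      (∀ j, a j ∈ A) → (∃ q : Fin d → ℝ, ∀ j, ∑ k, a j k * q k ≤ b j) →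
      ∀ (p : Fin d → ℝ) (r : ℝ), 0 ≤ r → (∀ j, ∑ k, a j k * p k ≤ b j + r) →
        ∃ q : Fin d → ℝ, (∀ j, ∑ k, a j k * q k ≤ b j) ∧ ∀ k, |p k - q k| ≤ K * r := by
  induction d with
  | zero =>
    exact ⟨0, le_rfl, fun J _ a b _ ⟨q, hq⟩ p r _ _ => ⟨q, hq, fun k => k.elim0⟩⟩
  | succ d ih =>
    -- Rows possible after eliminating coordinate 0: tails of rows not involving it, and normalized
    -- upper-bound rows minus normalized lower-bound rows.
    obtain ⟨K, hK, H⟩ := ih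
      (Fin.tail '' A ∪ Set.image2
        (fun x y k => (x 0)⁻¹ * Fin.tail x k - (y 0)⁻¹ * Fin.tail y k) A A)
      ((hA.image _).union (hA.image2 _ hA))
    obtain ⟨c, hc⟩ := (hA.image fun x : Fin (d + 1) → ℝ => |(x 0)⁻¹|).bddAbove
    obtain ⟨N, hN⟩ :=
      (hA.image fun x : Fin (d + 1) → ℝ => ∑ k, |(x 0)⁻¹ * Fin.tail x k|).bddAbove
    replace hc : ∀ x ∈ A, |(x 0)⁻¹| ≤ |c| := fun x hx =>
      (hc ⟨x, hx, rfl⟩).trans (le_abs_self c)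
    replace hN : ∀ x ∈ A, ∑ k, |(x 0)⁻¹ * Fin.tail x k| ≤ |N| := fun x hx =>
      (hN ⟨x, hx, rfl⟩).trans (le_abs_self N)
    have hc0 := abs_nonneg c
    have hN0 := abs_nonneg N
    set c := |c|
    set N := |N|
    have hK1 : 0 ≤ K * (2 * c + 1) := by positivity
    -- Combined rows are violated by at most 2cr and kept rows by r, so 2c + 1 covers both.
    -- Coordinate 0 then moves by cr for its own slack plus the effect of moving the tail, where N
    -- bounds the ℓ¹ norm of a normalized tail.
    refine ⟨K * (2 * c + 1) + (c + N * (K * (2 * c + 1))), by positivity, ?_⟩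
    intro J _ a b ha hfeas p r hr hp
    let S : J → (Fin d → ℝ) → ℝ := fun j x => ∑ k, Fin.tail (a j) k * x k
    have hS : ∀ (j : J) (x : Fin (d + 1) → ℝ),
        ∑ k, a j k * x k = a j 0 * x 0 + S j (Fin.tail x) := fun j x => by
      rw [Fin.sum_univ_succ]; rfl
    have key : ∀ (j : J) (x0 : ℝ) (x : Fin d → ℝ) (β : ℝ), (0 < a j 0 →
        (a j 0 * x0 + S j x ≤ β ↔ x0 ≤ (a j 0)⁻¹ * (β - S j x))) ∧ (a j 0 < 0 →
        (a j 0 * x0 + S j x ≤ β ↔ (a j 0)⁻¹ * (β - S j x) ≤ x0)) := by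
      intro j x0 x β
      constructor
      · intro h
        rw [inv_mul_eq_div, le_div_iff₀ h, mul_comm x0]
        constructor <;> intro _ <;> linarith
      · intro h
        rw [inv_mul_eq_div, div_le_iff_of_neg h, mul_comm x0]
        constructor <;> intro _ <;> linarith
    have hcomb : ∀ (i j : J) (x : Fin d → ℝ),
        ∑ k, ((a i 0)⁻¹ * Fin.tail (a i) k - (a j 0)⁻¹ * Fin.tail (a j) k) * x k =
          (a i 0)⁻¹ * S i x - (a j 0)⁻¹ * S j x := by
      intro i j x
      simp only [S, Finset.mul_sum, ← Finset.sum_sub_distrib]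
      exact Finset.sum_congr rfl fun k _ => by ring
    obtain ⟨q', hq', hpq'⟩ := H ({j // a j 0 = 0} ⊕ ({i // 0 < a i 0} × {j // a j 0 < 0}))
      (Sum.elim (fun j => Fin.tail (a j)) fun z k =>
        (a z.1 0)⁻¹ * Fin.tail (a z.1) k - (a z.2 0)⁻¹ * Fin.tail (a z.2) k)
      (Sum.elim (fun j => b j) fun z => (a z.1 0)⁻¹ * b z.1 - (a z.2 0)⁻¹ * b z.2)
      (by
        rintro (j | z)
        · exact Or.inl ⟨_, ha _, rfl⟩
        · exact Or.inr ⟨_, ha _, _, ha _, rfl⟩)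
      (by
        obtain ⟨q, hq⟩ := hfeas
        refine ⟨Fin.tail q, ?_⟩
        rintro (⟨j, hj⟩ | ⟨⟨i, hi⟩, ⟨j, hj⟩⟩)
        · have := hq j
          rw [hS, hj] at this
          simpa using this
        · have h₁ := hq i
          have h₂ := hq j
          rw [hS, (key _ _ _ _).1 hi] at h₁
          rw [hS, (key _ _ _ _).2 hj] at h₂
          simp only [Sum.elim_inr]
          rw [hcomb]
          linarith)
      (Fin.tail p) ((2 * c + 1) * r) (by positivity)
      (by
        rintro (⟨j, hj⟩ | ⟨⟨i, hi⟩, ⟨j, hj⟩⟩)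
        · have := hp j
          rw [hS, hj] at this
          have h₃ : 0 ≤ c * r := by positivity
          simp only [Sum.elim_inl]
          change S j (Fin.tail p) ≤ _
          linarith
        · have h₁ := hp i
          have h₂ := hp j
          rw [hS, (key _ _ _ _).1 hi] at h₁
          rw [hS, (key _ _ _ _).2 hj] at h₂
          have h₃ := mul_le_mul_of_nonneg_right ((le_abs_self _).trans (hc _ (ha i))) hr
          have h₄ := mul_le_mul_of_nonneg_right ((neg_le_abs _).trans (hc _ (ha j))) hr
          simp only [Sum.elim_inr]
          rw [hcomb]
          linarith)
    have hdiff : ∀ j, |(a j 0)⁻¹ * S j (Fin.tail p) - (a j 0)⁻¹ * S j q'| ≤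
        N * (K * (2 * c + 1)) * r := by
      intro j
      have : (a j 0)⁻¹ * S j (Fin.tail p) - (a j 0)⁻¹ * S j q' =
          ∑ k, ((a j 0)⁻¹ * Fin.tail (a j) k) * (Fin.tail p k - q' k) := by
        simp only [S, Finset.mul_sum, ← Finset.sum_sub_distrib]
        exact Finset.sum_congr rfl fun k _ => by ring
      rw [this]
      calc _ ≤ ∑ k, |((a j 0)⁻¹ * Fin.tail (a j) k) * (Fin.tail p k - q' k)| :=
            Finset.abs_sum_le_sum_abs _ _
        _ ≤ ∑ k, |(a j 0)⁻¹ * Fin.tail (a j) k| * (K * ((2 * c + 1) * r)) :=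
            Finset.sum_le_sum fun k _ => by
              rw [abs_mul]
              exact mul_le_mul_of_nonneg_left (hpq' k) (abs_nonneg _)
        _ ≤ N * (K * ((2 * c + 1) * r)) := by
            rw [← Finset.sum_mul]
            exact mul_le_mul_of_nonneg_right (hN _ (ha j)) (by positivity)
        _ = _ := by ring
    obtain ⟨q0, hl, hu, hq0⟩ := exists_abs_sub_le_of_forall_le
      (fun j : {j // a j 0 < 0} => (a j 0)⁻¹ * (b j - S j q'))
      (fun i : {i // 0 < a i 0} => (a i 0)⁻¹ * (b i - S i q'))
      (p 0) ((c + N * (K * (2 * c + 1))) * r) (by positivity)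
      (by
        intro j i
        have := hq' (Sum.inr (i, j))
        simp only [Sum.elim_inr] at this
        rw [hcomb] at this
        linarith)
      (by
        rintro ⟨j, hj⟩
        have h₂ := hp j
        rw [hS, (key _ _ _ _).2 hj] at h₂
        have h₄ := mul_le_mul_of_nonneg_right ((neg_le_abs _).trans (hc _ (ha j))) hr
        have h₅ := abs_le.1 (hdiff j)
        simp only
        linarith)
      (by
        rintro ⟨j, hj⟩
        have h₂ := hp j
        rw [hS, (key _ _ _ _).1 hj] at h₂
        have h₄ := mul_le_mul_of_nonneg_right ((le_abs_self _).trans (hc _ (ha j))) hr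
        have h₅ := abs_le.1 (hdiff j)
        simp only
        linarith)
    refine ⟨Fin.cons q0 q', fun j => ?_, fun k => ?_⟩
    · rw [hS, Fin.cons_zero, Fin.tail_cons]
      rcases lt_trichotomy (a j 0) 0 with h | h | h
      · exact ((key _ _ _ _).2 h).2 (hl ⟨j, h⟩)
      · rw [h, zero_mul, zero_add]
        exact hq' (Sum.inl ⟨j, h⟩)
      · exact ((key _ _ _ _).1 h).2 (hu ⟨j, h⟩)
    · refine Fin.cases ?_ (fun k => ?_) k
      · rw [Fin.cons_zero]
        refine hq0.trans (mul_le_mul_of_nonneg_right ?_ hr)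
        linarith
      · rw [Fin.cons_succ]
        refine (hpq' k).trans ?_
        rw [← mul_assoc]
        refine mul_le_mul_of_nonneg_right ?_ hr
        have : 0 ≤ c + N * (K * (2 * c + 1)) := by positivity
        linarith

/-! ### The potential and its minimizers -/

namespace Market

section Chi

variable {I Ω : Type*} (M : Market I Ω)

theorem sum_chi [Fintype I] (ω : Ω) : ∑ i, M.chi i ω = 0 := by
  classical
  have h : ∀ i, M.chi i ω = (if M.buyer ω = i then 1 else 0) - if M.seller ω = i then 1 else 0 := by
    intro i
    have := M.buyer_ne_seller ω
    unfold chi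
    split_ifs with h₁ h₂ <;> first | exact absurd (h₁.trans h₂.symm) this | norm_num
  simp [h]

theorem chi_eq_zero [Fintype Ω] {i : I} {ω : Ω} (h : ω ∉ M.trades i) : M.chi i ω = 0 := by
  simp only [trades, Finset.mem_filter, Finset.mem_univ, true_and, not_or] at h
  simp [chi, h.1, h.2]

theorem abs_chi_le_one (i : I) (ω : Ω) : |M.chi i ω| ≤ 1 := by
  unfold chi
  split_ifs <;> simp

theorem abs_sum_chi_mul_le [Fintype Ω] {B : ℝ} (i : I) (Ψ : Finset Ω) {p : Ω → ℝ} (hp : ∀ ω, |p ω| ≤ B) :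
    |∑ ω ∈ Ψ, M.chi i ω * p ω| ≤ Fintype.card Ω * B := by
  calc _ ≤ ∑ ω ∈ Ψ, |M.chi i ω * p ω| := Finset.abs_sum_le_sum_abs _ _
    _ ≤ ∑ ω, |M.chi i ω * p ω| :=
        Finset.sum_le_sum_of_subset_of_nonneg (Finset.subset_univ _) fun _ _ _ => abs_nonneg _
    _ ≤ ∑ _ω : Ω, B := Finset.sum_le_sum fun ω _ => by
        rw [abs_mul]
        simpa using mul_le_mul (M.abs_chi_le_one i ω) (hp ω) (abs_nonneg _) zero_le_one
    _ = _ := by simp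

end Chi

section Potential

variable {I Ω : Type*} [Fintype Ω] [LinearOrder Ω] (M : Market I Ω)

theorem tieBreak_mem_demand (i : I) (p : Ω → ℝ) : M.tieBreak i p ∈ M.demand i p :=
  (M.exists_tieBreak i p).choose_spec.1

theorem utility_le_utility_tieBreak (i : I) (p : Ω → ℝ) {Ψ : Finset Ω} (h : Ψ ⊆ M.trades i) :
    M.utility i Ψ p ≤ M.utility i (M.tieBreak i p) p :=
  (M.tieBreak_mem_demand i p).2 Ψ h

variable [Fintype I]

/-- The sum of the agents' indirect utilities, the Lyapunov function of the price dynamics. -/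
noncomputable def potential (p : Ω → ℝ) : ℝ := ∑ i, M.utility i (M.tieBreak i p) p

/-- What the buyer of a trade pays, its seller receives. -/
theorem sum_sum_inter_trades (Φ : Finset Ω) (f : Ω → ℝ) :
    ∑ i, ∑ ω ∈ Φ ∩ M.trades i, M.chi i ω * f ω = 0 := by
  have h : ∀ i, ∑ ω ∈ Φ ∩ M.trades i, M.chi i ω * f ω = ∑ ω ∈ Φ, M.chi i ω * f ω := fun i =>
    Finset.sum_subset Finset.inter_subset_left fun ω hω hω' => by
      rw [M.chi_eq_zero fun h => hω' (Finset.mem_inter.2 ⟨hω, h⟩), zero_mul]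
  simp only [h]
  rw [Finset.sum_comm]
  exact Finset.sum_eq_zero fun ω _ => by rw [← Finset.sum_mul, M.sum_chi, zero_mul]

theorem sum_utility_inter_trades (Φ : Finset Ω) (p : Ω → ℝ) :
    ∑ i, M.utility i (Φ ∩ M.trades i) p = ∑ i, M.v i (Φ ∩ M.trades i) := by
  simp only [utility, Finset.sum_sub_distrib, M.sum_sum_inter_trades, sub_zero]

theorem sum_utility_le_potential (p : Ω → ℝ) (Ψ : I → Finset Ω) (h : ∀ i, Ψ i ⊆ M.trades i) :
    ∑ i, M.utility i (Ψ i) p ≤ M.potential p :=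
  Finset.sum_le_sum fun i _ => M.utility_le_utility_tieBreak i p (h i)

theorem potential_nonneg (p : Ω → ℝ) : 0 ≤ M.potential p := by
  simpa [utility, M.v_empty] using
    M.sum_utility_le_potential p (fun _ => ∅) fun _ => Finset.empty_subset _

theorem potential_eq_of_isCompetitiveEquilibrium {p : Ω → ℝ} {Φ : Finset Ω}
    (h : M.IsCompetitiveEquilibrium p Φ) : M.potential p = ∑ i, M.v i (Φ ∩ M.trades i) := by
  classical
  rw [← M.sum_utility_inter_trades Φ p]
  refine Finset.sum_congr rfl fun i _ => le_antisymm ?_ ?_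
  · have h' : Φ ∩ M.trades i ∈ M.demand i p := by convert h i
    exact h'.2 _ (M.tieBreak_mem_demand i p).1
  · exact M.utility_le_utility_tieBreak i p Finset.inter_subset_right

theorem potential_le_of_mem_equilibriumPrices {q : Ω → ℝ} (hq : q ∈ M.equilibriumPrices)
    (p : Ω → ℝ) : M.potential q ≤ M.potential p := by
  obtain ⟨Φ, hΦ⟩ := hq
  rw [M.potential_eq_of_isCompetitiveEquilibrium hΦ, ← M.sum_utility_inter_trades Φ p]
  exact M.sum_utility_le_potential p _ fun _ => Finset.inter_subset_right

/-- The allocation Φ supporting q has total utility independent of prices, so it attains the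
potential at p as well; termwise domination then forces every agent to demand its share of Φ at p.
-/
theorem mem_equilibriumPrices_of_potential_le {p q : Ω → ℝ} (hq : q ∈ M.equilibriumPrices)
    (h : M.potential p ≤ M.potential q) : p ∈ M.equilibriumPrices := by
  classical
  obtain ⟨Φ, hΦ⟩ := hq
  refine ⟨Φ, fun i => ?_⟩
  rw [M.potential_eq_of_isCompetitiveEquilibrium hΦ, ← M.sum_utility_inter_trades Φ p] at h
  have hle : ∀ i ∈ Finset.univ, M.utility i (Φ ∩ M.trades i) p ≤
      M.utility i (M.tieBreak i p) p := fun i _ =>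
    M.utility_le_utility_tieBreak i p Finset.inter_subset_right
  have heq := (Finset.sum_eq_sum_iff_of_le hle).1
    (le_antisymm (Finset.sum_le_sum hle) h) i (Finset.mem_univ i)
  have key : Φ ∩ M.trades i ∈ M.demand i p :=
    ⟨Finset.inter_subset_right, fun Ψ hΨ => heq ▸ M.utility_le_utility_tieBreak i p hΨ⟩
  convert key

theorem potential_le {R : ℝ} (hv : M.ValuationsBoundedBy R) {p : Ω → ℝ} (hp : ∀ ω, |p ω| ≤ R) :
    M.potential p ≤ Fintype.card I * (R + Fintype.card Ω * R) := by
  calc M.potential p ≤ ∑ _i : I, (R + Fintype.card Ω * R) := Finset.sum_le_sum fun i _ => by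
        have h₁ := abs_le.1 (hv i _ (M.tieBreak_mem_demand i p).1)
        have h₂ := abs_le.1 (M.abs_sum_chi_mul_le i (M.tieBreak i p) hp)
        unfold utility
        linarith
    _ = _ := by simp [mul_add]

/-- Convexity: the bundles chosen at the average give an affine minorant of the potential that is
exact there. -/
theorem potential_average_le {T : ℕ} (hT : 0 < T) (x : ℕ → Ω → ℝ) :
    M.potential ((1 / (T : ℝ)) • ∑ t ∈ Finset.range T, x t) ≤
      (1 / (T : ℝ)) * ∑ t ∈ Finset.range T, M.potential (x t) := by
  have hT' : (T : ℝ) ≠ 0 := by positivity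
  set y := (1 / (T : ℝ)) • ∑ t ∈ Finset.range T, x t with hy
  have h : M.potential y = (1 / (T : ℝ)) * ∑ t ∈ Finset.range T,
      ∑ i, M.utility i (M.tieBreak i y) (x t) := by
    rw [Finset.sum_comm, Finset.mul_sum]
    refine Finset.sum_congr rfl fun i _ => ?_
    simp only [utility, Finset.sum_sub_distrib]
    rw [Finset.sum_comm]
    simp only [← Finset.mul_sum, mul_sub]
    congr 1
    · simp [hT']
    · rw [Finset.mul_sum]
      refine Finset.sum_congr rfl fun ω _ => ?_
      conv_lhs => rw [hy]
      simp only [Pi.smul_apply, Finset.sum_apply, smul_eq_mul]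
      ring
  rw [h]
  refine mul_le_mul_of_nonneg_left (Finset.sum_le_sum fun t _ => ?_) (by positivity)
  exact M.sum_utility_le_potential _ _ fun i => (M.tieBreak_mem_demand i y).1

end Potential

end Market

/-- Error bound for the potential, with a constant that depends only on the number of trades. -/
theorem Market.exists_dist_le_mul_potential_sub.{u₁, u₂} (m : ℕ) :
    ∃ K : ℝ, 0 ≤ K ∧ ∀ (I : Type u₁) (Ω : Type u₂) [Fintype I] [Fintype Ω] [LinearOrder Ω]
      (M : Market I Ω), Fintype.card Ω = m → ∀ q₀ ∈ M.equilibriumPrices, ∀ p : Ω → ℝ,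
        ∃ q ∈ M.equilibriumPrices, dist p q ≤ K * (M.potential p - M.potential q₀) := by
  classical
  obtain ⟨K, hK, H⟩ := exists_hoffman_bound.{max u₁ u₂} m
    (Set.univ.pi fun _ => ({-1, 0, 1} : Set ℝ)) (Set.Finite.pi fun _ => Set.toFinite _)
  refine ⟨K, hK, fun I Ω _ _ _ M hm q₀ hq₀ p => ?_⟩
  let e : Ω ≃ Fin m := Fintype.equivFinOfCardEq hm
  -- Gradient of total utility in the prices when the bundles Ψ are held fixed.
  let c : (I → Finset Ω) → Ω → ℝ := fun Ψ ω =>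
    (if ω ∈ Ψ (M.seller ω) then 1 else 0) - if ω ∈ Ψ (M.buyer ω) then 1 else 0
  have hc : ∀ (Ψ : I → Finset Ω) (x : Ω → ℝ),
      ∑ i, M.utility i (Ψ i ∩ M.trades i) x =
        ∑ i, M.v i (Ψ i ∩ M.trades i) + ∑ ω, c Ψ ω * x ω := by
    intro Ψ x
    simp only [Market.utility, Finset.sum_sub_distrib]
    rw [sub_eq_add_neg]
    congr 1
    have h : ∀ i, ∑ ω ∈ Ψ i ∩ M.trades i, M.chi i ω * x ω =
        ∑ ω, (if ω ∈ Ψ i then 1 else 0) * M.chi i ω * x ω := by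
      intro i
      rw [← Finset.sum_subset (Finset.subset_univ (Ψ i ∩ M.trades i))]
      · refine Finset.sum_congr rfl fun ω hω => ?_
        rw [if_pos (Finset.mem_inter.1 hω).1, one_mul]
      · intro ω _ hω
        by_cases h : ω ∈ Ψ i
        · rw [M.chi_eq_zero fun h' => hω (Finset.mem_inter.2 ⟨h, h'⟩)]
          simp
        · simp [h]
    simp only [h]
    rw [Finset.sum_comm, ← Finset.sum_neg_distrib]
    refine Finset.sum_congr rfl fun ω _ => ?_
    rw [← Finset.sum_mul, ← neg_mul]
    congr 1
    have hchi : ∀ i, (if ω ∈ Ψ i then (1 : ℝ) else 0) * M.chi i ω =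
        (if M.buyer ω = i then (if ω ∈ Ψ i then 1 else 0) else 0) -
          if M.seller ω = i then (if ω ∈ Ψ i then 1 else 0) else 0 := by
      intro i
      have := M.buyer_ne_seller ω
      unfold Market.chi
      by_cases h₁ : M.buyer ω = i
      · have h₂ : M.seller ω ≠ i := fun h => this (h₁.trans h.symm)
        simp [h₁, h₂]
      · by_cases h₂ : M.seller ω = i <;> simp [h₁, h₂]
    simp only [hchi, Finset.sum_sub_distrib, Finset.sum_ite_eq, Finset.mem_univ, if_true, c]
    ring
  have hcA : ∀ Ψ, (fun k => c Ψ (e.symm k)) ∈ Set.univ.pi fun _ => ({-1, 0, 1} : Set ℝ) := by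
    intro Ψ k _
    simp only [c]
    split_ifs <;> simp
  clear_value c
  have hsum : ∀ (Ψ : I → Finset Ω) (x : Fin m → ℝ),
      ∑ k, c Ψ (e.symm k) * x k = ∑ ω, c Ψ ω * x (e ω) := fun Ψ x => by
    rw [← e.sum_comp]
    simp
  have hpot : ∀ (x : Ω → ℝ) (Ψ : I → Finset Ω),
      ∑ i, M.v i (Ψ i ∩ M.trades i) + ∑ ω, c Ψ ω * x ω ≤ M.potential x := fun x Ψ => by
    rw [← hc]
    exact M.sum_utility_le_potential x _ fun _ => Finset.inter_subset_right
  have hr : 0 ≤ M.potential p - M.potential q₀ :=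
    sub_nonneg.2 (M.potential_le_of_mem_equilibriumPrices hq₀ p)
  -- The system says that no affine piece exceeds the minimum of the potential; p violates each row
  -- by at most its potential gap.
  obtain ⟨q, hq, hpq⟩ := H (I → Finset Ω) (fun Ψ k => c Ψ (e.symm k))
    (fun Ψ => M.potential q₀ - ∑ i, M.v i (Ψ i ∩ M.trades i))
    hcA
    ⟨q₀ ∘ e.symm, fun Ψ => by
      rw [hsum]
      simpa using by linarith [hpot q₀ Ψ]⟩
    (p ∘ e.symm) _ hr (fun Ψ => by
      rw [hsum]
      simpa using by linarith [hpot p Ψ])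
  refine ⟨q ∘ e, ?_, ?_⟩
  · refine M.mem_equilibriumPrices_of_potential_le hq₀ ?_
    have h₁ := (hsum _ q).symm.trans_le (hq fun i => M.tieBreak i (q ∘ e))
    have h₂ := hc (fun i => M.tieBreak i (q ∘ e)) (q ∘ e)
    have h₃ : ∀ i, M.tieBreak i (q ∘ e) ∩ M.trades i = M.tieBreak i (q ∘ e) := fun i =>
      Finset.inter_eq_left.2 (M.tieBreak_mem_demand i _).1
    simp only [h₃] at h₁ h₂
    unfold Market.potential at *
    rw [h₂]
    simp only [Function.comp_apply]
    linarith
  · rw [dist_pi_le_iff (mul_nonneg hK hr)]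
    intro ω
    have := hpq (e ω)
    simpa [Real.dist_eq] using this

/-! ### The dynamics as stochastic subgradient descent -/

namespace Market

variable {I Ω : Type*} [Fintype Ω] [LinearOrder Ω] (M : Market I Ω)

theorem priceUpdate_eq (ε : ℝ) (i : I) (p : Ω → ℝ) (ω : Ω) :
    M.priceUpdate ε i p ω =
      p ω - ε * (if ω ∈ M.trades i \ M.tieBreak i p then M.chi i ω else 0) := by
  unfold priceUpdate
  split_ifs <;> simp

theorem price_cons (ε : ℝ) (p0 : Ω → ℝ) {T : ℕ} (i : I) (a : Fin T → I) (t : ℕ) :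
    M.price ε p0 (Fin.cons i a : Fin (T + 1) → I) (t + 1) =
      M.price ε (M.priceUpdate ε i p0) a t := by
  induction t with
  | zero => simp [price]
  | succ t ih =>
    rw [price, ih]
    by_cases h : t < T
    · rw [dif_pos (by omega)]
      conv_rhs => rw [price, dif_pos h]
      rfl
    · rw [dif_neg (by omega)]
      conv_rhs => rw [price, dif_neg h]

theorem dist_price_succ_le {ε : ℝ} (hε : 0 ≤ ε) (p0 : Ω → ℝ) {T : ℕ} (a : Fin T → I) (t : ℕ) :
    dist (M.price ε p0 a (t + 1)) (M.price ε p0 a t) ≤ ε := by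
  rw [dist_pi_le_iff hε]
  intro ω
  rw [price]
  split_ifs with h
  · rw [priceUpdate_eq, Real.dist_eq]
    split_ifs
    · have := mul_le_mul_of_nonneg_left (M.abs_chi_le_one (a ⟨t, h⟩) ω) hε
      rw [sub_sub_cancel_left, abs_neg, abs_mul, abs_of_nonneg hε]
      linarith
    · simpa using hε
  · simpa using hε

theorem dist_price_le {ε : ℝ} (hε : 0 ≤ ε) (p0 : Ω → ℝ) {T : ℕ} (a : Fin T → I) (t : ℕ) :
    dist (M.price ε p0 a t) p0 ≤ t * ε := by
  induction t with
  | zero => simp [price]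
  | succ t ih =>
    refine (dist_triangle _ (M.price ε p0 a t) _).trans ?_
    have := M.dist_price_succ_le hε p0 a t
    push_cast
    linarith

/-- Descent controls rounds 0 to T - 1, while the average runs over 1 to T; the two averages differ
by (p^T - p^0)/T. -/
theorem dist_averagePrice_le {ε : ℝ} (hε : 0 ≤ ε) (p0 : Ω → ℝ) {T : ℕ} (hT : 0 < T)
    (a : Fin T → I) :
    dist (M.averagePrice ε p0 a) ((1 / (T : ℝ)) • ∑ t ∈ Finset.range T, M.price ε p0 a t) ≤ ε := by
  have hT' : (0 : ℝ) < T := by positivity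
  have hsum : ∑ t ∈ Finset.Icc 1 T, M.price ε p0 a t =
      ∑ t ∈ Finset.range T, M.price ε p0 a t + (M.price ε p0 a T - p0) := by
    have h : ∑ t ∈ Finset.Icc 1 T, M.price ε p0 a t =
        ∑ t ∈ Finset.range T, M.price ε p0 a (t + 1) := by
      rw [Finset.range_eq_Ico, Finset.sum_Ico_add' (fun t => M.price ε p0 a t)]
      rfl
    rw [h, ← add_sub_assoc, ← Finset.sum_range_succ, Finset.sum_range_succ']
    simp [price]
  rw [averagePrice, dist_smul₀, hsum, dist_self_add_left, ← dist_eq_norm, Real.norm_of_nonneg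
    (by positivity), one_div, inv_mul_le_iff₀ hT']
  exact M.dist_price_le hε p0 a T

variable [Fintype I]

/-- Subgradient inequality. Since χ sums to zero over agents, summing it over rejected trades gives
minus its sum over demanded trades, which is a subgradient at p. -/
theorem potential_sub_le_sum (p q : Ω → ℝ) :
    M.potential p - M.potential q ≤ ∑ i, ∑ ω,
      (if ω ∈ M.trades i \ M.tieBreak i p then M.chi i ω else 0) * (p ω - q ω) := by
  have h₁ : ∀ i, ∑ ω, (if ω ∈ M.trades i \ M.tieBreak i p then M.chi i ω else 0) * (p ω - q ω) =
      ∑ ω ∈ Finset.univ ∩ M.trades i, M.chi i ω * (p ω - q ω) -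
        ∑ ω ∈ M.tieBreak i p, M.chi i ω * (p ω - q ω) := by
    intro i
    rw [eq_sub_iff_add_eq, Finset.univ_inter,
      ← Finset.sum_sdiff (M.tieBreak_mem_demand i p).1]
    simp only [ite_mul, zero_mul, Finset.sum_ite_mem, Finset.univ_inter]
  have h₂ : ∀ i, ∑ ω ∈ M.tieBreak i p, M.chi i ω * (p ω - q ω) =
      M.utility i (M.tieBreak i p) q - M.utility i (M.tieBreak i p) p := by
    intro i
    simp only [utility, mul_sub, Finset.sum_sub_distrib]
    ring
  have h₃ := M.sum_utility_le_potential q (fun i => M.tieBreak i p) fun i =>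
    (M.tieBreak_mem_demand i p).1
  have h₄ := M.sum_sum_inter_trades Finset.univ fun ω => p ω - q ω
  have h₅ : M.potential p = ∑ i, M.utility i (M.tieBreak i p) p := rfl
  simp only [h₁, Finset.sum_sub_distrib, h₂]
  linarith

theorem sum_sq_priceUpdate_sub (ε : ℝ) (i : I) (p q : Ω → ℝ) :
    ∑ ω, (M.priceUpdate ε i p ω - q ω) ^ 2 ≤ ∑ ω, (p ω - q ω) ^ 2 - 2 * ε * ∑ ω,
      (if ω ∈ M.trades i \ M.tieBreak i p then M.chi i ω else 0) * (p ω - q ω) +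
        ε ^ 2 * M.maxDegree := by
  have h : ∑ ω, (if ω ∈ M.trades i \ M.tieBreak i p then M.chi i ω else 0) ^ 2 ≤
      (M.maxDegree : ℝ) := by
    calc _ ≤ ∑ ω, (if ω ∈ M.trades i then 1 else 0 : ℝ) := Finset.sum_le_sum fun ω _ => by
          by_cases h₁ : ω ∈ M.trades i
          · rw [if_pos h₁, sq_le_one_iff_abs_le_one]
            split_ifs
            · exact M.abs_chi_le_one i ω
            · simp
          · simp [h₁]
      _ = ((M.trades i).card : ℝ) := by simp
      _ ≤ _ := by
          exact_mod_cast Finset.le_sup (f := fun i => (M.trades i).card) (Finset.mem_univ i)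
  have h₂ := mul_le_mul_of_nonneg_left h (sq_nonneg ε)
  refine le_trans (le_of_eq ?_) (add_le_add_right h₂ _)
  simp only [Finset.mul_sum, ← Finset.sum_sub_distrib, ← Finset.sum_add_distrib, priceUpdate_eq]
  exact Finset.sum_congr rfl fun ω _ => by ring

theorem expect_sum_sq_priceUpdate_sub [Nonempty I] {ε : ℝ} (hε : 0 ≤ ε) (p q : Ω → ℝ) :
    𝔼 i, ∑ ω, (M.priceUpdate ε i p ω - q ω) ^ 2 ≤ ∑ ω, (p ω - q ω) ^ 2 -
      2 * ε / Fintype.card I * (M.potential p - M.potential q) + ε ^ 2 * M.maxDegree := by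
  refine (Finset.expect_le_expect fun i _ => M.sum_sq_priceUpdate_sub ε i p q).trans ?_
  rw [Finset.expect_add_distrib, Finset.expect_sub_distrib, Fintype.expect_const,
    Fintype.expect_const, ← Finset.mul_expect, Fintype.expect_eq_sum_div_card]
  have h := mul_le_mul_of_nonneg_left (M.potential_sub_le_sum p q)
    (by positivity : 0 ≤ 2 * ε / Fintype.card I)
  rw [mul_div_assoc', ← div_mul_eq_mul_div]
  linarith

theorem expect_fin_cons {T : ℕ} (f : (Fin (T + 1) → I) → ℝ) :
    𝔼 a, f a = 𝔼 i, 𝔼 a : Fin T → I, f (Fin.cons i a) := by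
  rw [← Finset.expect_product', Finset.univ_product_univ]
  exact (Fintype.expect_equiv (Fin.consEquiv fun _ => I) _ _ fun _ => rfl).symm

/-- Induction peels off the first round, after which the dynamics restarts from the updated price;
the one-step bounds on squared distance telescope. -/
theorem expect_sum_potential_sub_le [Nonempty I] {ε : ℝ} (hε : 0 ≤ ε) (q : Ω → ℝ) (T : ℕ)
    (p0 : Ω → ℝ) :
    𝔼 a : Fin T → I, ∑ t ∈ Finset.range T,
      2 * ε / Fintype.card I * (M.potential (M.price ε p0 a t) - M.potential q) ≤
        ∑ ω, (p0 ω - q ω) ^ 2 + T * (ε ^ 2 * M.maxDegree) := by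
  induction T generalizing p0 with
  | zero =>
    simpa using Finset.sum_nonneg fun ω _ => sq_nonneg (p0 ω - q ω)
  | succ T ih =>
    rw [expect_fin_cons]
    simp only [Finset.sum_range_succ', price_cons]
    simp only [Finset.expect_add_distrib, price, Fintype.expect_const]
    have h₁ := Finset.expect_le_expect fun i (_ : i ∈ Finset.univ) => ih (M.priceUpdate ε i p0)
    rw [Finset.expect_add_distrib, Fintype.expect_const] at h₁
    have h₂ := M.expect_sum_sq_priceUpdate_sub hε p0 q
    push_cast
    linarith

end Market

/-! ### The convergence rate -/

theorem mainTheorem5 (n m Δ : ℕ) (R : ℝ) :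
    ∃ C : ℝ, ∀ (I : Type*) (Ω : Type*) [Fintype I] [Fintype Ω] [LinearOrder Ω]
      (M : Market I Ω), Fintype.card I = n → Fintype.card Ω = m → M.maxDegree = Δ →
      M.ValuationsBoundedBy R → M.equilibriumPrices.Nonempty →
      ∀ p0 : Ω → ℝ, (∀ ω, p0 ω ∈ Set.Icc (-R) R) →
      ∀ T : ℕ, 0 < T → 2 * (n : ℝ) ^ 2 * R ^ 2 * m * Δ ≤ T →
        M.expectedDistance (R * √(2 * m / (T * Δ))) p0 T ≤ C / √T := by
  obtain ⟨K, hK, H⟩ := Market.exists_dist_le_mul_potential_sub m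
  -- The step size is e/√T, and B will bound the distance from the initial price to some
  -- equilibrium.
  set e := R * √(2 * m / Δ) with he
  set B := K * (n * (R + m * R)) with hB
  refine ⟨|K * (n / 2) * (m * B ^ 2 / e + e * Δ) + e|, ?_⟩
  intro I Ω _ _ _ M hn hm hΔ hv hne p0 hp0 T hT _
  have hT' : (0 : ℝ) < T := by positivity
  have hsT : 0 < √(T : ℝ) := Real.sqrt_pos.2 hT'
  have hε : R * √(2 * m / (T * Δ)) = e / √T := by
    rw [he, mul_comm (T : ℝ), ← div_div, Real.sqrt_div' _ hT'.le, ← mul_div_assoc]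
  rw [hε]
  obtain ⟨q₀, hq₀⟩ := hne
  have hp0' : ∀ ω, |p0 ω| ≤ R := fun ω => abs_le.2 (hp0 ω)
  have hinf : ∀ p : Ω → ℝ, Metric.infDist p M.equilibriumPrices ≤
      K * (M.potential p - M.potential q₀) := fun p => by
    obtain ⟨q, hq, h⟩ := H I Ω M hm q₀ hq₀ p
    exact (Metric.infDist_le_dist_of_mem hq).trans h
  cases isEmpty_or_nonempty Ω with
  | inl h =>
    have : ∀ a : Fin T → I,
        Metric.infDist (M.averagePrice (e / √T) p0 a) M.equilibriumPrices = 0 := fun a =>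
      Metric.infDist_zero_of_mem (by rwa [Subsingleton.elim (M.averagePrice _ _ _) q₀])
    simp only [Market.expectedDistance, this, Finset.expect_const_zero]
    positivity
  | inr hΩ =>
  obtain ⟨ω₀⟩ := hΩ
  have : Nonempty I := ⟨M.buyer ω₀⟩
  have hn0 : 0 < n := hn ▸ Fintype.card_pos
  have hm0 : 0 < m := hm ▸ Fintype.card_pos_iff.2 ⟨ω₀⟩
  have hΔ0 : 0 < Δ := by
    rw [← hΔ]
    refine lt_of_lt_of_le (Finset.card_pos.2 ⟨ω₀, ?_⟩)
      (Finset.le_sup (f := fun i => (M.trades i).card) (Finset.mem_univ (M.buyer ω₀)))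
    simp [Market.trades]
  have hR : 0 ≤ R := (abs_nonneg _).trans (hp0' ω₀)
  have he0 : 0 ≤ e := by positivity
  have hεT : 0 ≤ e / √T := by positivity
  -- The given q₀ may be arbitrarily far away, so descent is measured against an equilibrium q near
  -- the start.
  obtain ⟨q, hq, hpq⟩ := H I Ω M hm q₀ hq₀ p0
  replace hpq : dist p0 q ≤ B := hpq.trans (mul_le_mul_of_nonneg_left (by
    have h₁ := M.potential_le hv hp0'
    rw [hn, hm] at h₁
    linarith [M.potential_nonneg q₀]) hK)
  have hqq₀ : M.potential q = M.potential q₀ := le_antisymm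
    (M.potential_le_of_mem_equilibriumPrices hq _) (M.potential_le_of_mem_equilibriumPrices hq₀ _)
  refine le_trans ?_ (div_le_div_of_nonneg_right (le_abs_self _) hsT.le)
  -- The constant divides by e. If R = 0, then B = 0 and the step size vanishes, so prices start and
  -- stay at an equilibrium.
  rcases hR.eq_or_lt with hR0 | hRpos
  · have he' : e = 0 := by rw [he, ← hR0, zero_mul]
    have hB' : B = 0 := by rw [hB, ← hR0]; ring
    have hp : p0 = q := dist_le_zero.1 (hB' ▸ hpq)
    have : ∀ a : Fin T → I,
        Metric.infDist (M.averagePrice (e / √T) p0 a) M.equilibriumPrices = 0 := by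
      intro a
      rw [he', zero_div]
      have h : ∀ t, M.price 0 p0 a t = p0 := fun t =>
        dist_le_zero.1 (by simpa using M.dist_price_le le_rfl p0 a t)
      refine Metric.infDist_zero_of_mem ?_
      rw [Market.averagePrice]
      simp only [h, Finset.sum_const, Nat.card_Icc, Nat.add_sub_cancel]
      rw [← Nat.cast_smul_eq_nsmul ℝ, smul_smul, one_div_mul_cancel hT'.ne', one_smul, hp]
      exact hq
    simp only [Market.expectedDistance, this, Finset.expect_const_zero]
    rw [he']
    simp
  have hepos : 0 < e := by positivity
  have hbound : ∀ a : Fin T → I,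
      Metric.infDist (M.averagePrice (e / √T) p0 a) M.equilibriumPrices ≤
        K * (n / (2 * e * √T)) * ∑ t ∈ Finset.range T, 2 * (e / √T) / Fintype.card I *
          (M.potential (M.price (e / √T) p0 a t) - M.potential q) + e / √T := by
    intro a
    have h₁ := Metric.infDist_le_infDist_add_dist (s := M.equilibriumPrices)
      (x := M.averagePrice (e / √T) p0 a)
      (y := (1 / (T : ℝ)) • ∑ t ∈ Finset.range T, M.price (e / √T) p0 a t)
    have h₂ := M.dist_averagePrice_le hεT p0 hT a
    have h₃ := hinf ((1 / (T : ℝ)) • ∑ t ∈ Finset.range T, M.price (e / √T) p0 a t)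
    have h₄ := M.potential_average_le hT fun t => M.price (e / √T) p0 a t
    refine h₁.trans (add_le_add (h₃.trans ?_) h₂)
    rw [mul_assoc]
    refine mul_le_mul_of_nonneg_left ((sub_le_sub_right h₄ _).trans (le_of_eq ?_)) hK
    rw [← Finset.mul_sum, Finset.sum_sub_distrib, hn, hqq₀]
    simp only [Finset.sum_const, Finset.card_range, nsmul_eq_mul]
    have hn' : (n : ℝ) ≠ 0 := by positivity
    have hTs : (T : ℝ) = √T * √T := (Real.mul_self_sqrt hT'.le).symm
    have hcoef : (n : ℝ) / (2 * e * √T) * (2 * (e / √T) / n) = 1 / T := by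
      rw [hTs, Real.sqrt_mul_self hsT.le]
      field_simp
    rw [← mul_assoc, hcoef, mul_sub, ← mul_assoc (1 / (T : ℝ)), one_div_mul_cancel hT'.ne', one_mul]
  have hE := M.expect_sum_potential_sub_le hεT q T p0
  have hsq : ∑ ω, (p0 ω - q ω) ^ 2 ≤ m * B ^ 2 := by
    calc _ ≤ ∑ _ω : Ω, B ^ 2 := Finset.sum_le_sum fun ω _ =>
          sq_le_sq' (abs_le.1 ((dist_le_pi_dist p0 q ω).trans hpq)).1
            (abs_le.1 ((dist_le_pi_dist p0 q ω).trans hpq)).2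
      _ = _ := by simp [hm]
  have hc : 0 ≤ K * (n / (2 * e * √T)) := by positivity
  calc _ ≤ 𝔼 a : Fin T → I, (K * (n / (2 * e * √T)) * ∑ t ∈ Finset.range T,
        2 * (e / √T) / Fintype.card I *
          (M.potential (M.price (e / √T) p0 a t) - M.potential q) + e / √T) :=
        Finset.expect_le_expect fun a _ => hbound a
    _ ≤ K * (n / (2 * e * √T)) * (m * B ^ 2 + T * ((e / √T) ^ 2 * Δ)) + e / √T := by
        rw [Finset.expect_add_distrib, Fintype.expect_const, ← Finset.mul_expect]
        rw [hΔ] at hE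
        gcongr
        linarith
    _ = _ := by
        rw [div_pow, Real.sq_sqrt hT'.le]
        field_simp
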